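/- Let $X$ be a zero-dimensional metric space, that is, a metric space whose clopen subsets form a base of its topology. Let $X'$ be the derived set of $X$ (the set of all non-isolated points of $X$). Let $2=\{0,1\}$ be the discrete two-element group $\mathbb{Z}/2\mathbb{Z}$, and let $C_k(X,2)$ be the group of all continuous functions from $X$ to $2$, with pointwise addition and the compact-open topology. Let $2^\omega$ be the countable power of $2$ with the product topology, and let $(2^\omega)^\infty$ be the direct sum of countably many copies of the group $2^\omega$, with the topology induced by the box topology on the product of these copies. Then $C_k(X,2)$ is a sequential space if and only if $X$ is a Polish space and one of the following conditions holds: (a) $X$ is not locally compact but $X'$ is compact; (b) $X$ is locally compact. Moreover, if $X$ is Polish and (a) holds, then $C_k(X,2)$ has an open subgroup $H$ which is topologically isomorphic to $(2^\omega)^\infty$, and $C_k(X,2)$ is homeomorphic to $(2^\omega)^\infty$. If $X$ is Polish and (b) holds, then $C_k(X,2)$ is a Polish space. -/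

import Mathlib

open Topology

open scoped DirectSum

/-- A topological space is zero-dimensional if its clopen subsets form a base of its topology.
(The separation axiom usually included in the definition is automatic for metric spaces.) -/
def IsZeroDimensional (X : Type*) [TopologicalSpace X] : Prop :=
  TopologicalSpace.IsTopologicalBasis {U : Set X | IsClopen U}

/-- The box topology on a product of topological spaces: the boxes `∏ i, U i`, with every `U i`
open in `G i`, form a base. -/
abbrev boxTopology {ι : Type*} (G : ι → Type*) [∀ i, TopologicalSpace (G i)] :
    TopologicalSpace (∀ i, G i) :=
  TopologicalSpace.generateFrom
    {B | ∃ U : ∀ i, Set (G i), (∀ i, IsOpen (U i)) ∧ B = Set.pi Set.univ U}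

/-- `G^∞`: the (algebraic) direct sum of countably many copies of an abelian topological group `G`,
considered with the topology induced from the box topology of the product `∏ n, G`.
It is a type synonym, so that it carries no topology other than this one. -/
def BoxPower (G : Type*) [AddCommGroup G] : Type _ := ⨁ _ : ℕ, G

noncomputable instance (G : Type*) [AddCommGroup G] : AddCommGroup (BoxPower G) :=
  inferInstanceAs (AddCommGroup (⨁ _ : ℕ, G))

instance (G : Type*) [AddCommGroup G] [TopologicalSpace G] : TopologicalSpace (BoxPower G) :=
  TopologicalSpace.induced (fun (g : ⨁ _ : ℕ, G) (n : ℕ) => g n) (boxTopology fun _ : ℕ => G)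

/-- The Cantor group `2^ω`: the countable power of the discrete two-element group `ZMod 2`, with
coordinatewise addition and the product topology. -/
abbrev CantorGroup : Type := ℕ → ZMod 2

/-! Basic neighbourhoods in `C(X, ZMod 2)` prescribe values on a compact set.

Necessity: a sequential space admits no set that is sequentially closed but not closed. If some
point has no compact neighbourhood and the derived set is not compact, a double array of clopen
indicators is such a set (`not_sequentialSpace_of_clopen_array`). An uncountable uniformly separated
set yields another, so `X` is separable. Then `X` is Polish, being open or a countable intersection
of open sets in its completion.

Sufficiency: the locally compact case is standard. Otherwise the isolated points split into infinite
clopen pieces shrinking to the compact derived set `L`. A function vanishing on `L` vanishes on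
almost all pieces, and compact sets meet each piece in a finite set; hence these functions form a
copy of `BoxPower CantorGroup`, open and of countable index. That group absorbs countable discrete
factors and is sequential, by a compactness argument made one coordinate at a time. -/

section

open Set Filter

/-! ### Clopen sets and the compact-open topology. -/

theorem IsZeroDimensional.exists_isClopen_between {X : Type*} [TopologicalSpace X]
    (hX : IsZeroDimensional X) {K O : Set X} (hK : IsCompact K) (hO : IsOpen O) (hKO : K ⊆ O) :
    ∃ V, IsClopen V ∧ K ⊆ V ∧ V ⊆ O := by
  refine hK.induction_on (p := fun K => ∃ V, IsClopen V ∧ K ⊆ V ∧ V ⊆ O)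
    ⟨∅, isClopen_empty, Subset.rfl, empty_subset _⟩ ?_ ?_ ?_
  · rintro s t hst ⟨V, hV, htV, hVO⟩
    exact ⟨V, hV, hst.trans htV, hVO⟩
  · rintro s t ⟨V, hV, hsV, hVO⟩ ⟨W, hW, htW, hWO⟩
    exact ⟨V ∪ W, hV.union hW, union_subset_union hsV htW, union_subset hVO hWO⟩
  · intro x hx
    obtain ⟨V, hV, hxV, hVO⟩ := hX.exists_subset_of_mem_open (hKO hx) hO
    exact ⟨V, mem_nhdsWithin_of_mem_nhds (hV.isOpen.mem_nhds hxV), V, hV, Subset.rfl, hVO⟩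

theorem IsZeroDimensional.exists_isClopen_mem_subset {X : Type*} [TopologicalSpace X]
    (hX : IsZeroDimensional X) {x : X} {O : Set X} (hO : O ∈ 𝓝 x) :
    ∃ V, IsClopen V ∧ x ∈ V ∧ V ⊆ O := by
  obtain ⟨V, hV, hxV, hVO⟩ := hX.mem_nhds_iff.1 hO
  exact ⟨V, hV, hxV, hVO⟩

/-- In a space of continuous maps into a discrete space, basic neighbourhoods of `f` consist of the
maps that agree with `f` on a compact set. -/
theorem ContinuousMap.hasBasis_nhds_eqOn {X Y : Type*} [TopologicalSpace X] [TopologicalSpace Y]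
    [DiscreteTopology Y] (f : C(X, Y)) :
    (𝓝 f).HasBasis (fun K : Set X => IsCompact K) fun K => {g | EqOn g f K} := by
  refine ⟨fun s => ?_⟩
  rw [ContinuousMap.mem_nhds_iff]
  constructor
  · rintro ⟨S, hS, hf, hs⟩
    refine ⟨⋃ p ∈ S, p.1, hS.isCompact_biUnion fun p hp => (hf p.1 p.2 hp).1, fun g hg => hs ?_⟩
    intro K U hKU x hx
    have : g x = f x := hg (mem_biUnion hKU hx)
    rw [this]
    exact (hf K U hKU).2.2 hx
  · rintro ⟨K, hK, hs⟩
    refine ⟨(fun c : Y => (K ∩ f ⁻¹' {c}, {c})) '' (f '' K), ?_, ?_, fun g hg => hs fun x hx => ?_⟩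
    · exact ((hK.image f.continuous).finite_of_discrete).image _
    · rintro _ _ ⟨c, -, h⟩
      obtain ⟨rfl, rfl⟩ := Prod.mk.inj h
      refine ⟨hK.inter_right ((isClosed_discrete {c}).preimage f.continuous),
        isOpen_discrete _, fun x hx => hx.2⟩
    · exact hg _ _ ⟨f x, mem_image_of_mem f hx, rfl⟩ ⟨hx, rfl⟩

/-- The continuous `ZMod 2`-valued indicator function of a clopen set. -/
noncomputable def clopenIndicator {X : Type*} [TopologicalSpace X] (V : Set X) (hV : IsClopen V) :
    C(X, ZMod 2) where
  toFun := V.indicator 1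
  continuous_toFun := (IsClopen.continuous_indicator hV) continuous_one

theorem clopenIndicator_of_mem {X : Type*} [TopologicalSpace X] {V : Set X} (hV : IsClopen V)
    {x : X} (hx : x ∈ V) : clopenIndicator V hV x = 1 :=
  indicator_of_mem hx _

theorem clopenIndicator_of_notMem {X : Type*} [TopologicalSpace X] {V : Set X} (hV : IsClopen V)
    {x : X} (hx : x ∉ V) : clopenIndicator V hV x = 0 :=
  indicator_of_notMem hx _

theorem ContinuousMap.eventually_eqOn_of_tendsto {X Y ι : Type*} [TopologicalSpace X]
    [TopologicalSpace Y] [DiscreteTopology Y] {l : Filter ι} {u : ι → C(X, Y)} {f : C(X, Y)}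
    (hu : Tendsto u l (𝓝 f)) {K : Set X} (hK : IsCompact K) : ∀ᶠ i in l, EqOn (u i) f K :=
  hu.eventually (f.hasBasis_nhds_eqOn.mem_of_mem hK)

/-- If continuous maps into a discrete space converge in the compact-open topology, then they
eventually take the limit value along every convergent sequence of points. -/
theorem ContinuousMap.eventually_apply_eq_of_tendsto {X Y : Type*} [TopologicalSpace X]
    [TopologicalSpace Y] [DiscreteTopology Y] {u : ℕ → C(X, Y)} {f : C(X, Y)}
    (hu : Tendsto u atTop (𝓝 f)) {p : ℕ → X} {x : X} (hp : Tendsto p atTop (𝓝 x)) :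
    ∀ᶠ i in atTop, u i (p i) = f x := by
  have h1 := eventually_eqOn_of_tendsto hu hp.isCompact_insert_range
  have h2 : ∀ᶠ i in atTop, f (p i) = f x :=
    (f.continuous.continuousAt.tendsto.comp hp).eventually_mem
      ((isOpen_discrete {f x}).mem_nhds rfl)
  filter_upwards [h1, h2] with i h1 h2
  rw [h1 (mem_insert_of_mem _ (mem_range_self i)), h2]

/-! ### Necessity: local compactness or a compact derived set. -/

theorem exists_frequently_eq_or_tendsto_atTop (s : ℕ → ℕ) :
    (∃ c, ∃ φ : ℕ → ℕ, StrictMono φ ∧ ∀ i, s (φ i) = c) ∨ Tendsto s atTop atTop := by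
  by_cases h : ∃ c, ∃ᶠ i in atTop, s i = c
  · obtain ⟨c, hc⟩ := h
    exact Or.inl ⟨c, extraction_of_frequently_atTop hc⟩
  · right
    rw [← Nat.cofinite_eq_atTop, Tendsto, le_cofinite_iff_eventually_ne]
    intro c
    simp only [not_exists, not_frequently] at h
    rw [eventually_map, Nat.cofinite_eq_atTop]
    exact h c

/-- The indicators of the `F n k` form a sequentially closed set without `0`. Along a convergent
sequence of them, `n → ∞` is impossible because of the points `p` tending to `x`, and `n` fixed with
`k → ∞` because of `q n` tending to `y n`; so some indicator recurs and is the limit. By `hK`, `0`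
lies in the closure. -/
theorem not_sequentialSpace_of_clopen_array {X : Type*} [TopologicalSpace X]
    {F : ℕ → ℕ → Set X} (hF : ∀ n k, IsClopen (F n k)) {x : X} {y : ℕ → X} {p q : ℕ → ℕ → X}
    (hx : ∀ n k, x ∉ F n k) (hy : ∀ n k, y n ∉ F n k) (hpF : ∀ n k, p n k ∈ F n k)
    (hqF : ∀ n k, q n k ∈ F n k)
    (hp : ∀ n k : ℕ → ℕ, Tendsto n atTop atTop → Tendsto (fun i => p (n i) (k i)) atTop (𝓝 x))
    (hq : ∀ n, Tendsto (q n) atTop (𝓝 (y n)))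
    (hK : ∀ K, IsCompact K → ∃ n k, Disjoint K (F n k)) :
    ¬ SequentialSpace C(X, ZMod 2) := by
  intro hseq
  let A : Set C(X, ZMod 2) := {f | ∃ n k, clopenIndicator (F n k) (hF n k) = f}
  have hA : IsSeqClosed A := by
    intro u f hu huf
    choose n k hnk using hu
    rcases exists_frequently_eq_or_tendsto_atTop n with ⟨c, φ, hφ, hc⟩ | hn
    · have huφ := huf.comp hφ.tendsto_atTop
      rcases exists_frequently_eq_or_tendsto_atTop (k ∘ φ) with ⟨d, ψ, hψ, hd⟩ | hk
      · have huψ := huφ.comp hψ.tendsto_atTop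
        refine ⟨c, d, tendsto_nhds_unique (tendsto_const_nhds.congr fun i => ?_) huψ⟩
        simp only [Function.comp_apply] at hd ⊢
        rw [← hnk]
        congr 1
        rw [hc, hd]
      · have h1 := ContinuousMap.eventually_apply_eq_of_tendsto huφ ((hq c).comp hk)
        have h2 := ContinuousMap.eventually_apply_eq_of_tendsto huφ
          (tendsto_const_nhds (x := y c))
        obtain ⟨i, h1, h2⟩ := (h1.and h2).exists
        have h3 := h1.trans h2.symm
        simp only [Function.comp_apply, ← hnk] at h3
        rw [clopenIndicator_of_mem _ (by rw [hc]; exact hqF _ _),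
          clopenIndicator_of_notMem _ (by rw [hc]; exact hy _ _)] at h3
        exact absurd h3 (by decide)
    · have h1 := ContinuousMap.eventually_apply_eq_of_tendsto huf (hp n k hn)
      have h2 := ContinuousMap.eventually_apply_eq_of_tendsto huf (tendsto_const_nhds (x := x))
      obtain ⟨i, h1, h2⟩ := (h1.and h2).exists
      have h3 := h1.trans h2.symm
      rw [← hnk, clopenIndicator_of_mem _ (hpF _ _), clopenIndicator_of_notMem _ (hx _ _)] at h3
      exact absurd h3 (by decide)
  have h0 : (0 : C(X, ZMod 2)) ∈ A := by
    rw [← hA.isClosed.closure_eq]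
    refine (mem_closure_iff_nhds_basis (0 : C(X, ZMod 2)).hasBasis_nhds_eqOn).2 fun K hKc => ?_
    obtain ⟨n, k, hd⟩ := hK K hKc
    exact ⟨_, ⟨n, k, rfl⟩, fun z hz => clopenIndicator_of_notMem _ (hd.notMem_of_mem_left hz)⟩
  obtain ⟨n, k, h⟩ := h0
  have h1 := clopenIndicator_of_mem (hF n k) (hpF n k)
  rw [h] at h1
  simp at h1

/-- A noncompact closed subset of a metric space contains a sequence without cluster points. -/
theorem IsClosed.exists_seq_forall_not_mapClusterPt {X : Type*} [PseudoMetricSpace X] {s : Set X}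
    (hs : IsClosed s) (hc : ¬ IsCompact s) :
    ∃ p : ℕ → X, (∀ n, p n ∈ s) ∧ ∀ x, ¬ MapClusterPt x atTop p := by
  rw [isCompact_iff_isSeqCompact, IsSeqCompact] at hc
  push Not at hc
  obtain ⟨p, hp, h⟩ := hc
  refine ⟨p, hp, fun x hx => ?_⟩
  obtain ⟨φ, hφ, hlim⟩ := MapClusterPt.tendsto_subseq hx
  exact h x (hs.mem_of_tendsto hlim (Eventually.of_forall fun n => hp _)) φ hφ hlim

/-- Shrinking neighbourhoods of a sequence without cluster points eventually miss every compact
set. -/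
theorem IsCompact.eventually_disjoint_ball {X : Type*} [PseudoMetricSpace X] {p : ℕ → X}
    (hp : ∀ x, ¬ MapClusterPt x atTop p) {r : ℕ → ℝ} (hr : Tendsto r atTop (𝓝 0)) {K : Set X}
    (hK : IsCompact K) : ∀ᶠ n in atTop, Disjoint K (Metric.ball (p n) (r n)) := by
  by_contra hcon
  obtain ⟨φ, hφ, h⟩ := extraction_of_frequently_atTop (not_eventually.1 hcon)
  simp only [Set.not_disjoint_iff] at h
  choose z hzK hz using h
  obtain ⟨x, -, ψ, hψ, hlim⟩ := hK.tendsto_subseq hzK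
  refine hp x ?_
  have hφψ := hφ.tendsto_atTop.comp hψ.tendsto_atTop
  have : Tendsto (p ∘ φ ∘ ψ) atTop (𝓝 x) := by
    refine hlim.congr_dist (squeeze_zero (fun _ => dist_nonneg) (fun i => (hz (ψ i)).le)
      (hr.comp hφψ))
  exact this.mapClusterPt.of_comp hφψ

/-- Take `x` without compact neighbourhoods and non-isolated points `y n` without cluster point.
Each `F n k` joins a small clopen set at `p n k`, where `p n` has no cluster point and stays close
to `x`, to one at `q n k`, close to `y n`. -/
theorem locallyCompactSpace_or_isCompact_derivedSet {X : Type*} [MetricSpace X]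
    (hX : IsZeroDimensional X) (hseq : SequentialSpace C(X, ZMod 2)) :
    LocallyCompactSpace X ∨ IsCompact (derivedSet (univ : Set X)) := by
  by_contra! hcon
  obtain ⟨hlc, hd⟩ := hcon
  have hr := tendsto_one_div_add_atTop_nhds_zero_nat (𝕜 := ℝ)
  have hr0 : ∀ n : ℕ, 0 < 1 / ((n : ℝ) + 1) := fun n => Nat.one_div_pos_of_nat
  obtain ⟨x, hx⟩ : ∃ x : X, ∀ s ∈ 𝓝 x, ¬ IsCompact s := by
    by_contra! h
    have : WeaklyLocallyCompactSpace X := ⟨fun x => (h x).imp fun s hs => hs.symm⟩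
    exact hlc inferInstance
  obtain ⟨y, hyd, hy⟩ := (isClosed_derivedSet (univ : Set X)).exists_seq_forall_not_mapClusterPt hd
  have hp : ∀ n : ℕ, ∃ p : ℕ → X, (∀ k, p k ∈ Metric.closedBall x (1 / ((n : ℝ) + 1))) ∧
      (∀ k, p k ≠ x) ∧ (∀ k, p k ≠ y n) ∧ ∀ z, ¬ MapClusterPt z atTop p := by
    intro n
    obtain ⟨p, hpb, hpc⟩ := (Metric.isClosed_closedBall (x := x)
      (ε := 1 / ((n : ℝ) + 1))).exists_seq_forall_not_mapClusterPt
      (hx _ (Metric.closedBall_mem_nhds x (hr0 n)))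
    have hne : ∀ z, ∀ᶠ k in atTop, p k ≠ z := fun z => by
      have := hpc z
      rw [mapClusterPt_iff_frequently] at this
      push Not at this
      obtain ⟨s, hs, h⟩ := this
      filter_upwards [h] with k hk hkz
      exact hk (hkz ▸ mem_of_mem_nhds hs)
    -- Dropping finitely many terms makes the sequence avoid `x` and `y n`.
    obtain ⟨N, hN⟩ := eventually_atTop.1 ((hne x).and (hne (y n)))
    refine ⟨fun k => p (k + N), fun k => hpb _, fun k => (hN _ (Nat.le_add_left N k)).1,
      fun k => (hN _ (Nat.le_add_left N k)).2, fun z hz => hpc z ?_⟩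
    exact MapClusterPt.of_comp (tendsto_add_atTop_nat N) hz
  choose p hpb hpx hpy hpc using hp
  have hq : ∀ n k : ℕ, ∃ q ∈ Metric.ball (y n) (1 / ((n : ℝ) + 1)),
      q ∈ Metric.ball (y n) (1 / ((k : ℝ) + 1)) ∧ q ≠ y n ∧ q ≠ x := by
    intro n k
    have h1 : (𝓝[≠] (y n)).NeBot := by simpa [derivedSet, AccPt] using hyd n
    have h2 : ∀ᶠ q in 𝓝[≠] (y n), q ≠ x := by
      by_cases h : y n = x
      · rw [← h]; exact self_mem_nhdsWithin
      · exact eventually_nhdsWithin_of_eventually_nhds (isOpen_ne.mem_nhds h)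
    have h3 : ∀ m : ℕ, ∀ᶠ q in 𝓝[≠] (y n), q ∈ Metric.ball (y n) (1 / ((m : ℝ) + 1)) :=
      fun m => mem_nhdsWithin_of_mem_nhds (Metric.ball_mem_nhds _ (hr0 m))
    have h4 : ∀ᶠ q in 𝓝[≠] (y n), q ≠ y n := self_mem_nhdsWithin
    obtain ⟨q, ⟨⟨h3, h4⟩, h5⟩, h6⟩ := ((((h3 n).and (h3 k)).and h4).and h2).exists
    exact ⟨q, h3, h4, h5, h6⟩
  choose q hqn hqk hqy hqx using hq
  have hP : ∀ n k, ∃ V, IsClopen V ∧ p n k ∈ V ∧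
      V ⊆ Metric.ball (p n k) (1 / ((k : ℝ) + 1)) ∩ {x, y n}ᶜ := fun n k =>
    hX.exists_isClopen_mem_subset (inter_mem (Metric.ball_mem_nhds _ (hr0 k))
      ((toFinite {x, y n}).isClosed.isOpen_compl.mem_nhds (by simp [hpx, hpy])))
  have hQ : ∀ n k, ∃ V, IsClopen V ∧ q n k ∈ V ∧
      V ⊆ Metric.ball (y n) (1 / ((n : ℝ) + 1)) ∩ {x, y n}ᶜ := fun n k =>
    hX.exists_isClopen_mem_subset (inter_mem (Metric.isOpen_ball.mem_nhds (hqn n k))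
      ((toFinite {x, y n}).isClosed.isOpen_compl.mem_nhds (by simp [hqx, hqy])))
  choose P hPc hpP hPs using hP
  choose Q hQc hqQ hQs using hQ
  refine not_sequentialSpace_of_clopen_array (F := fun n k => P n k ∪ Q n k)
    (fun n k => (hPc n k).union (hQc n k)) (x := x) (y := y) (p := p) (q := q) ?_ ?_
    (fun n k => Or.inl (hpP n k)) (fun n k => Or.inr (hqQ n k)) ?_ ?_ ?_ hseq
  · rintro n k (h | h)
    exacts [(hPs n k h).2 (by simp), (hQs n k h).2 (by simp)]
  · rintro n k (h | h)
    exacts [(hPs n k h).2 (by simp), (hQs n k h).2 (by simp)]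
  · intro n k hn
    rw [tendsto_iff_dist_tendsto_zero]
    exact squeeze_zero (fun _ => dist_nonneg) (fun i => hpb _ _) (hr.comp hn)
  · intro n
    rw [tendsto_iff_dist_tendsto_zero]
    exact squeeze_zero (fun _ => dist_nonneg) (fun k => (hqk n k).le) hr
  -- The order matters: `n` is chosen so that the ball at `y n`, which contains every `Q n k`,
  -- misses `K`; then `k` is chosen for `P n k`.
  · intro K hK
    obtain ⟨n, hn⟩ := (hK.eventually_disjoint_ball hy hr).exists
    obtain ⟨k, hk⟩ := (hK.eventually_disjoint_ball (hpc n) hr).exists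
    exact ⟨n, k, (hk.mono_right fun z hz => (hPs n k hz).1).union_right
      (hn.mono_right fun z hz => (hQs n k hz).1)⟩

/-! ### Necessity: second countability. -/

/-- Functions equal to `1` at only countably many points of `D` form a sequentially closed set. A
compact `K` meets `D` in a finite set, so the indicator of a clopen set containing `K` and missing
`D \ K` is among them; thus `1` is in the closure. -/
theorem countable_of_pairwise_le_dist_of_sequentialSpace {X : Type*} [MetricSpace X]
    (hX : IsZeroDimensional X) (hseq : SequentialSpace C(X, ZMod 2)) {D : Set X} {ε : ℝ}
    (hε : 0 < ε) (hD : D.Pairwise fun x y => ε ≤ dist x y) : D.Countable := by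
  let A : Set C(X, ZMod 2) := {f | {x ∈ D | f x = 1}.Countable}
  have hA : IsSeqClosed A := by
    intro u f hu huf
    refine (countable_iUnion hu).mono fun x hx => mem_iUnion.2 ?_
    obtain ⟨i, hi⟩ :=
      (ContinuousMap.eventually_apply_eq_of_tendsto huf (tendsto_const_nhds (x := x))).exists
    exact ⟨i, hx.1, hi.trans hx.2⟩
  have h1 : (1 : C(X, ZMod 2)) ∈ A := by
    rw [← hA.isClosed.closure_eq]
    refine (mem_closure_iff_nhds_basis (1 : C(X, ZMod 2)).hasBasis_nhds_eqOn).2 fun K hK => ?_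
    have hfin : (K ∩ D).Finite := by
      refine (hK.inter_right (Metric.isClosed_of_pairwise_le_dist hε hD)).finite ⟨?_⟩
      exact .of_forall_le_dist hε fun x y hxy =>
        hD x.2.2 y.2.2 (Subtype.coe_injective.ne hxy)
    have hcl : IsClosed (D \ K) :=
      Metric.isClosed_of_pairwise_le_dist hε (hD.mono sdiff_subset)
    obtain ⟨V, hV, hKV, hVD⟩ := hX.exists_isClopen_between hK hcl.isOpen_compl
      fun x hx h => h.2 hx
    refine ⟨clopenIndicator V hV, hfin.countable.mono ?_,
      fun x hx => clopenIndicator_of_mem hV (hKV hx)⟩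
    rintro x ⟨hxD, hx⟩
    have hxV : x ∈ V := by
      by_contra h
      rw [clopenIndicator_of_notMem hV h] at hx
      simp at hx
    exact ⟨by_contra fun h => hVD hxV ⟨hxD, h⟩, hxD⟩
  refine Countable.mono (fun x hx => ?_) h1
  exact ⟨hx, rfl⟩

theorem secondCountableTopology_of_sequentialSpace {X : Type*} [MetricSpace X]
    (hX : IsZeroDimensional X) (hseq : SequentialSpace C(X, ZMod 2)) :
    SecondCountableTopology X := by
  refine Metric.secondCountable_of_almost_dense_set fun ε hε => ?_
  obtain ⟨D, hD⟩ := zorn_subset {D : Set X | D.Pairwise fun x y => ε ≤ dist x y}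
    fun c hc hchain => ⟨⋃₀ c, (pairwise_sUnion hchain.directedOn).2 hc,
      fun s hs => subset_sUnion_of_mem hs⟩
  refine ⟨D, countable_of_pairwise_le_dist_of_sequentialSpace hX hseq hε hD.prop, fun x => ?_⟩
  by_contra! h
  have hins : (insert x D).Pairwise fun x y => ε ≤ dist x y :=
    hD.prop.insert fun y hy _ => ⟨(h y hy).le, by rw [dist_comm]; exact (h y hy).le⟩
  have hxD : x ∈ D := hD.le_of_ge hins (subset_insert x D) (mem_insert x D)
  have := h x hxD
  rw [dist_self] at this
  exact lt_asymm this hε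

/-! ### Polish spaces inside the completion. -/

/-- The diagonal embeds the intersection as a closed subset of the product of the `U n`. -/
theorem polishSpace_iInter_of_isOpen {Y : Type*} [TopologicalSpace Y] [PolishSpace Y]
    {U : ℕ → Set Y} (hU : ∀ n, IsOpen (U n)) : PolishSpace (⋂ n, U n) := by
  have hp : ∀ n, PolishSpace (U n) := fun n => (hU n).polishSpace
  let f : (⋂ n, U n) → ∀ n, U n := fun x n => ⟨x, mem_iInter.1 x.2 n⟩
  have hf : Continuous f := by fun_prop
  have hr : range f = {u | ∀ n, (u n : Y) = u 0} := by
    ext u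
    constructor
    · rintro ⟨x, rfl⟩ n
      rfl
    · intro hu
      refine ⟨⟨u 0, mem_iInter.2 fun n => ?_⟩, ?_⟩
      · rw [← hu n]; exact (u n).2
      · ext n
        exact (hu n).symm
  refine IsClosedEmbedding.polishSpace (f := f) ⟨⟨?_, ?_⟩, ?_⟩
  · refine .of_comp hf (g := fun u => (u 0 : Y)) (by fun_prop) ?_
    exact IsInducing.subtypeVal
  · intro x y h
    exact Subtype.ext (congrArg (fun u => ((u 0 : U 0) : Y)) h)
  · rw [hr]
    simp only [ofPred_forall]
    exact isClosed_iInter fun n => isClosed_eq (by fun_prop) (by fun_prop)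

theorem polishSpace_of_isEmbedding_of_range_eq_iInter {X Y : Type*} [TopologicalSpace X]
    [TopologicalSpace Y] [PolishSpace Y] {f : X → Y} (hf : IsEmbedding f) {U : ℕ → Set Y} (hU : ∀ n, IsOpen (U n))
    (hr : range f = ⋂ n, U n) : PolishSpace X := by
  have := polishSpace_iInter_of_isOpen hU
  rw [← hr] at this
  exact hf.toHomeomorph.isClosedEmbedding.polishSpace

/-- A neighbourhood of a point in a dense subspace whose image is closed in the ambient space is a
neighbourhood there. -/
theorem IsDenseInducing.image_mem_nhds_of_isClosed {X Y : Type*} [TopologicalSpace X]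
    [TopologicalSpace Y] {f : X → Y} (hf : IsDenseInducing f) {x : X} {K : Set X} (hK : K ∈ 𝓝 x)
    (hc : IsClosed (f '' K)) : f '' K ∈ 𝓝 (f x) := by
  have := hf.closure_image_mem_nhds hK
  rwa [hc.closure_eq] at this

theorem polishSpace_of_locallyCompactSpace {X : Type*} [MetricSpace X]
    [SecondCountableTopology X] [LocallyCompactSpace X] : PolishSpace X := by
  have hd : IsDenseInducing ((↑) : X → UniformSpace.Completion X) :=
    UniformSpace.Completion.isDenseInducing_coe
  refine polishSpace_of_isEmbedding_of_range_eq_iInter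
    UniformSpace.Completion.coe_isometry.isEmbedding
    (U := fun _ : ℕ => range ((↑) : X → UniformSpace.Completion X))
    (fun _ : ℕ => isOpen_iff_mem_nhds.2 ?_) (iInter_const _).symm
  rintro _ ⟨x, rfl⟩
  obtain ⟨K, hK, hKx⟩ := exists_compact_mem_nhds x
  exact mem_of_superset (hd.image_mem_nhds_of_isClosed hKx
    (hK.image hd.continuous).isClosed) (image_subset_range _ _)

theorem isOpen_singleton_of_notMem_derivedSet {X : Type*} [TopologicalSpace X] {x : X}
    (hx : x ∉ derivedSet (univ : Set X)) : IsOpen {x} := by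
  rw [isOpen_singleton_iff_punctured_nhds]
  simpa [derivedSet, AccPt, neBot_iff] using hx

/-- Isolated points of `X` stay isolated in the completion, so `I` is open there. The compact `L` is
the intersection of its thickenings, and the union of `L` and `I` is the image of `X`. -/
theorem polishSpace_of_isCompact_derivedSet {X : Type*} [MetricSpace X]
    [SecondCountableTopology X] (h : IsCompact (derivedSet (univ : Set X))) : PolishSpace X := by
  have hd : IsDenseInducing ((↑) : X → UniformSpace.Completion X) :=
    UniformSpace.Completion.isDenseInducing_coe
  let L : Set (UniformSpace.Completion X) := (↑) '' derivedSet (univ : Set X)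
  let I : Set (UniformSpace.Completion X) := (↑) '' (derivedSet (univ : Set X))ᶜ
  have hL : IsClosed L := (h.image hd.continuous).isClosed
  have hI : IsOpen I := by
    refine isOpen_iff_mem_nhds.2 ?_
    rintro _ ⟨x, hx, rfl⟩
    have hx' := (isOpen_singleton_of_notMem_derivedSet hx).mem_nhds (mem_singleton x)
    refine mem_of_superset (hd.image_mem_nhds_of_isClosed hx' ?_)
      (image_mono (singleton_subset_iff.2 hx))
    rw [image_singleton]
    exact isClosed_singleton
  refine polishSpace_of_isEmbedding_of_range_eq_iInter
    UniformSpace.Completion.coe_isometry.isEmbedding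
    (U := fun n : ℕ => Metric.thickening (1 / ((n : ℝ) + 1)) L ∪ I)
    (fun n => Metric.isOpen_thickening.union hI) ?_
  rw [← iInter_union, ← image_univ, ← union_compl_self (derivedSet (univ : Set X)), image_union]
  congr 1
  change L = _
  conv_lhs => rw [← hL.closure_eq, Metric.closure_eq_iInter_thickening' L
    (range fun n : ℕ => 1 / ((n : ℝ) + 1)) (by
      rintro _ ⟨n, rfl⟩
      exact Nat.one_div_pos_of_nat (α := ℝ))
    (fun ε hε => by
      obtain ⟨n, hn⟩ := exists_nat_one_div_lt hε
      exact ⟨_, ⟨n, rfl⟩, Nat.one_div_pos_of_nat, hn.le⟩)]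
  simp

theorem polishSpace_continuousMap_of_locallyCompactSpace {X : Type*} [TopologicalSpace X]
    [SecondCountableTopology X] [LocallyCompactSpace X] : PolishSpace C(X, ZMod 2) := by
  -- The discrete uniformity is countably generated, as instance search for a Polish function space
  -- needs.
  let : UniformSpace (ZMod 2) := ⊥
  have : (uniformity (ZMod 2)).IsCountablyGenerated :=
    inferInstanceAs (𝓟 SetRel.id).IsCountablyGenerated
  infer_instance

/-! ### The box power of the Cantor group is sequential. -/

theorem boxTopology_isTopologicalBasis {ι : Type*} (G : ι → Type*) [∀ i, TopologicalSpace (G i)] :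
    @TopologicalSpace.IsTopologicalBasis _ (boxTopology G)
      {B | ∃ U : ∀ i, Set (G i), (∀ i, IsOpen (U i)) ∧ B = Set.pi Set.univ U} := by
  let := boxTopology G
  refine ⟨?_, ?_, rfl⟩
  · rintro _ ⟨U, hU, rfl⟩ _ ⟨V, hV, rfl⟩ x hx
    exact ⟨_, ⟨fun i => U i ∩ V i, fun i => (hU i).inter (hV i), rfl⟩,
      by rwa [pi_inter_distrib], by rw [pi_inter_distrib]⟩
  · exact eq_univ_of_forall fun x => mem_sUnion.2
      ⟨_, ⟨fun _ => univ, fun _ => isOpen_univ, rfl⟩, fun _ _ => mem_univ _⟩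

namespace BoxPower

variable {G : Type*} [AddCommGroup G]

/-- The sequence of coordinates of an element of `BoxPower G`. -/
def coord (g : BoxPower G) (n : ℕ) : G := (show ⨁ _ : ℕ, G from g) n

theorem coord_injective : Function.Injective (coord : BoxPower G → ℕ → G) :=
  DFunLike.coe_injective (F := ⨁ _ : ℕ, G)

theorem coord_add (g h : BoxPower G) (n : ℕ) : (g + h).coord n = g.coord n + h.coord n :=
  DFinsupp.add_apply (β := fun _ : ℕ => G) g h n

theorem exists_coord_eq {x : ℕ → G} {N : ℕ} (hx : ∀ n, N ≤ n → x n = 0) :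
    ∃ g : BoxPower G, g.coord = x := by
  refine ⟨DFinsupp.mk (Finset.range N) fun n => x n, funext fun n => ?_⟩
  change (DFinsupp.mk (β := fun _ : ℕ => G) (Finset.range N) fun n => x n) n = x n
  rw [DFinsupp.mk_apply]
  split_ifs with h
  · rfl
  · exact (hx n (by simpa using h)).symm

theorem exists_forall_coord_eq_zero (g : BoxPower G) : ∃ N, ∀ n, N ≤ n → g.coord n = 0 := by
  classical
  let g' : Π₀ _ : ℕ, G := g
  refine ⟨g'.support.sup id + 1, fun n hn => ?_⟩
  by_contra h
  have : n ∈ g'.support := DFinsupp.mem_support_iff.2 h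
  have := Finset.le_sup (f := id) this
  simp only [id] at this
  omega

theorem hasBasis_nhds (g : BoxPower CantorGroup) :
    (𝓝 g).HasBasis (fun _ : ℕ → Finset ℕ => True)
      fun F => {h | ∀ n, ∀ m ∈ F n, h.coord n m = g.coord n m} := by
  have h1 := (@TopologicalSpace.IsTopologicalBasis.nhds_hasBasis _ (boxTopology _) _
    (boxTopology_isTopologicalBasis fun _ : ℕ => CantorGroup) g.coord).comap coord
  have h2 : 𝓝 g = comap coord (@nhds _ (boxTopology fun _ : ℕ => CantorGroup) g.coord) :=
    @nhds_induced _ _ (boxTopology fun _ : ℕ => CantorGroup) coord g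
  rw [h2]
  refine h1.to_hasBasis ?_ ?_
  · rintro _ ⟨⟨U, hU, rfl⟩, hg⟩
    have := fun n => isOpen_pi_iff.1 (hU n) (g.coord n) (hg n trivial)
    choose F u hu hFu using this
    refine ⟨F, trivial, fun h hh n _ => hFu n fun m hm => ?_⟩
    rw [hh n m hm]
    exact (hu n m hm).2
  · intro F _
    refine ⟨_, ⟨⟨fun n => {x | ∀ m ∈ F n, x m = g.coord n m}, fun n => ?_, rfl⟩,
      fun n _ m _ => rfl⟩, fun h hh n m hm => hh n trivial m hm⟩
    have : {x : CantorGroup | ∀ m ∈ F n, x m = g.coord n m} =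
        (F n : Set ℕ).pi fun m => {g.coord n m} := by ext; simp [Set.pi]
    change IsOpen {x : CantorGroup | ∀ m ∈ F n, x m = g.coord n m}
    rw [this]
    exact isOpen_set_pi (F n).finite_toSet fun _ _ => isOpen_discrete _

/-- If no `T` worked, the counterexamples for `T = range k` would subconverge coordinatewise by
compactness. They equal `g` beyond `n`, so only finitely many coordinates move and the convergence
holds in the box topology. The limit lies in `s` and equals `g` from `n` on, against `h`. -/
theorem exists_next_finset {s : Set (BoxPower CantorGroup)} (hs : IsSeqClosed s)
    (g : BoxPower CantorGroup) (F : ℕ → Finset ℕ) (n : ℕ)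
    (h : ∀ x ∈ s, (∀ i < n, ∀ m ∈ F i, x.coord i m = g.coord i m) →
      (∀ i, n ≤ i → x.coord i = g.coord i) → False) :
    ∃ T : Finset ℕ, ∀ x ∈ s, (∀ i < n, ∀ m ∈ F i, x.coord i m = g.coord i m) →
      (∀ m ∈ T, x.coord n m = g.coord n m) →
      (∀ i, n < i → x.coord i = g.coord i) → False := by
  by_contra! hcon
  choose x hxs hxF hxT hxg using fun k => hcon (Finset.range k)
  obtain ⟨γ, φ, hφ, hγ⟩ := CompactSpace.tendsto_subseq fun k => (x k).coord
  have hγ' : ∀ i m, ∀ᶠ k in atTop, (x (φ k)).coord i m = γ i m := fun i m =>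
    ((tendsto_pi_nhds.1 (tendsto_pi_nhds.1 hγ i) m).eventually_mem
      ((isOpen_discrete {γ i m}).mem_nhds rfl))
  have hγg : ∀ i, n ≤ i → γ i = g.coord i := by
    intro i hi
    funext m
    obtain ⟨k, hk, hkm⟩ := ((hγ' i m).and (hφ.tendsto_atTop.eventually_gt_atTop m)).exists
    rw [← hk]
    rcases hi.eq_or_lt with rfl | hi
    · exact hxT _ _ (Finset.mem_range.2 hkm)
    · rw [(hxg _).1 _ hi]
  obtain ⟨N, hN⟩ := g.exists_forall_coord_eq_zero
  obtain ⟨z, rfl⟩ := exists_coord_eq (x := γ) (N := max n N) fun i hi => by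
    rw [hγg i (le_of_max_le_left hi), hN i (le_of_max_le_right hi)]
  have hlim : Tendsto (x ∘ φ) atTop (𝓝 z) := by
    refine z.hasBasis_nhds.tendsto_right_iff.2 fun E _ => ?_
    have : ∀ᶠ k in atTop, ∀ i ∈ Finset.range (n + 1), ∀ m ∈ E i,
        (x (φ k)).coord i m = z.coord i m :=
      (Finset.eventually_all _).2 fun i _ => (Finset.eventually_all _).2 fun m _ => hγ' i m
    filter_upwards [this] with k hk i m hm
    by_cases hi : i ∈ Finset.range (n + 1)
    · exact hk i hi m hm
    · simp only [Finset.mem_range, not_lt] at hi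
      rw [hγg i (by omega)]
      exact congrFun ((hxg _).1 i (by omega)) m
  refine h z (hs (fun k => hxs _) hlim) (fun i hi m hm => ?_) hγg
  obtain ⟨k, hk⟩ := (hγ' i m).exists
  rw [← hk, hxF _ i hi m hm]

instance : SequentialSpace (BoxPower CantorGroup) := by
  refine ⟨fun s hs => isOpen_compl_iff.1 (isOpen_iff_mem_nhds.2 fun g hg => ?_)⟩
  -- Invariant of the recursion: the first `n` finite sets already exclude every point of `s` that
  -- equals `g` from coordinate `n` on.
  let P : ℕ → (ℕ → Finset ℕ) → Prop := fun n F =>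
    ∀ x ∈ s, (∀ i < n, ∀ m ∈ F i, x.coord i m = g.coord i m) →
      (∀ i, n ≤ i → x.coord i = g.coord i) → False
  have hstep : ∀ n F, P n F → ∃ T, P (n + 1) (Function.update F n T) := by
    intro n F h
    obtain ⟨T, hT⟩ := exists_next_finset hs g F n h
    refine ⟨T, fun x hx h1 h2 => hT x hx (fun i hi m hm => h1 i (by omega) m ?_)
      (fun m hm => h1 n (by omega) m ?_) h2⟩
    · rwa [Function.update_of_ne hi.ne]
    · rwa [Function.update_self]
  choose! T hT using hstep
  have h0 : P 0 fun _ => ∅ := by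
    intro x hx _ h
    have : x = g := coord_injective (funext fun i => h i (Nat.zero_le i))
    exact hg (this ▸ hx)
  let Φ : ℕ → ℕ → Finset ℕ := fun n =>
    Nat.rec (fun _ => ∅) (fun n F => Function.update F n (T n F)) n
  have hΦ : ∀ n, P n (Φ n) := fun n => Nat.rec h0 (fun n ih => hT n _ ih) n
  have hΦeq : ∀ i n, i < n → Φ n i = Φ (i + 1) i := by
    intro i n hin
    induction n, hin using Nat.le_induction with
    | base => rfl
    | succ n hn ih =>
      rw [← ih]
      exact Function.update_of_ne (by omega) _ _
  refine (g.hasBasis_nhds.mem_iff).2 ⟨fun i => Φ (i + 1) i, trivial, fun x hx hxs => ?_⟩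
  obtain ⟨N, hN⟩ := g.exists_forall_coord_eq_zero
  obtain ⟨M, hM⟩ := x.exists_forall_coord_eq_zero
  -- Both `x` and `g` vanish from `max N M` on, so that stage of the recursion already excludes `x`.
  refine hΦ (max N M) x hxs (fun i hi m hm => hx i m ?_) fun i hi => ?_
  · change m ∈ Φ (i + 1) i
    rwa [← hΦeq i _ hi]
  · rw [hN i (le_of_max_le_left hi), hM i (le_of_max_le_right hi)]

end BoxPower

/-! ### Absorbing countable discrete factors. -/

namespace BoxPower

/-- `BoxPower CantorGroup` is a topological sum of countably many copies of itself. -/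
theorem nonempty_homeomorph_nat_prod :
    Nonempty (ℕ × BoxPower CantorGroup ≃ₜ BoxPower CantorGroup) := by
  -- The entries `g.coord n 0` form a finitely supported sequence, which `ε` encodes as a natural
  -- number; the other entries shift down by one.
  obtain ⟨ε⟩ : Nonempty (ℕ ≃ (ℕ →₀ ZMod 2)) := nonempty_equiv_of_countable
  have hex : ∀ p : ℕ × BoxPower CantorGroup, ∃ g : BoxPower CantorGroup,
      g.coord = fun n m => Nat.casesOn m (ε p.1 n) fun m => p.2.coord n m := by
    intro p
    obtain ⟨N, hN⟩ := p.2.exists_forall_coord_eq_zero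
    refine exists_coord_eq (N := max N ((ε p.1).support.sup id + 1)) fun n hn => ?_
    funext m
    cases m with
    | zero =>
      by_contra h
      have := Finset.le_sup (f := id) (Finsupp.mem_support_iff.2 h)
      have := le_of_max_le_right hn
      simp only [id] at *
      omega
    | succ m => exact congrFun (hN n (le_of_max_le_left hn)) m
  choose Ψ hΨ using hex
  have hΨ0 : ∀ p n, (Ψ p).coord n 0 = ε p.1 n := fun p n =>
    congrFun (congrFun (hΨ p) n) 0
  have hΨs : ∀ p n m, (Ψ p).coord n (m + 1) = p.2.coord n m := fun p n m =>
    congrFun (congrFun (hΨ p) n) (m + 1)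
  have hbij : Function.Bijective Ψ := by
    constructor
    · intro p q hpq
      refine Prod.ext (ε.injective (Finsupp.ext fun n => ?_))
        (coord_injective (funext fun n => funext fun m => ?_))
      · rw [← hΨ0, ← hΨ0, hpq]
      · rw [← hΨs, ← hΨs, hpq]
    · intro g
      obtain ⟨N, hN⟩ := g.exists_forall_coord_eq_zero
      have hfin : (Function.support fun n => g.coord n 0).Finite := by
        refine (finite_lt_nat N).subset fun n hn => ?_
        by_contra h
        exact hn (congrFun (hN n (not_lt.1 h)) 0)
      obtain ⟨h, hh⟩ := exists_coord_eq (x := fun n m => g.coord n (m + 1)) (N := N)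
        fun n hn => funext fun m => congrFun (hN n hn) (m + 1)
      refine ⟨(ε.symm (Finsupp.ofSupportFinite _ hfin), h),
        coord_injective (funext fun n => funext fun m => ?_)⟩
      cases m with
      | zero => rw [hΨ0]; simp [Finsupp.ofSupportFinite_coe]
      | succ m => rw [hΨs, hh]
  let A := Equiv.ofBijective Ψ hbij
  have hA0 : ∀ g n, ε (A.symm g).1 n = g.coord n 0 := fun g n => by
    rw [← hΨ0]; exact congrArg (fun g => g.coord n 0) (A.apply_symm_apply g)
  have hAs : ∀ g n m, (A.symm g).2.coord n m = g.coord n (m + 1) := fun g n m => by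
    rw [← hΨs]; exact congrArg (fun g => g.coord n (m + 1)) (A.apply_symm_apply g)
  refine ⟨A, ?_, ?_⟩
  · refine continuous_prod_of_discrete_left.2 fun k => continuous_iff_continuousAt.2 fun h => ?_
    refine (h.hasBasis_nhds.tendsto_iff (Ψ (k, h)).hasBasis_nhds).2
      fun F _ => ⟨fun n => (F n).image Nat.pred, trivial, fun h' hh n m hm => ?_⟩
    change (Ψ (k, h')).coord n m = _
    cases m with
    | zero => rw [hΨ0, hΨ0]
    | succ m =>
      rw [hΨs, hΨs]
      exact hh n m (Finset.mem_image.2 ⟨_, hm, rfl⟩)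
  · refine continuous_iff_continuousAt.2 fun g => ?_
    change Tendsto A.symm (𝓝 g) (𝓝 ((A.symm g).1, (A.symm g).2))
    refine Tendsto.prodMk_nhds (mx := fun g => (A.symm g).1) (my := fun g => (A.symm g).2) ?_ ?_
    · rw [nhds_discrete ℕ, tendsto_pure]
      -- The box topology allows fixing the zeroth entries of all coordinates at once, so the code
      -- is locally constant.
      filter_upwards [g.hasBasis_nhds.mem_of_mem (i := fun _ => {0}) trivial] with g' hg'
      refine ε.injective (Finsupp.ext fun n => ?_)
      rw [hA0, hA0]
      exact hg' n 0 (by simp)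
    · refine (g.hasBasis_nhds.tendsto_iff (A.symm g).2.hasBasis_nhds).2
        fun F _ => ⟨fun n => (F n).image Nat.succ, trivial, fun g' hg' n m hm => ?_⟩
      rw [hAs, hAs]
      exact hg' n (m + 1) (Finset.mem_image.2 ⟨m, hm, rfl⟩)

theorem nonempty_homeomorph_prod (D : Type*) [TopologicalSpace D] [DiscreteTopology D]
    [Countable D] [Nonempty D] :
    Nonempty (D × BoxPower CantorGroup ≃ₜ BoxPower CantorGroup) := by
  obtain ⟨A⟩ := nonempty_homeomorph_nat_prod
  obtain ⟨ε⟩ : Nonempty (D × ℕ ≃ ℕ) := nonempty_equiv_of_countable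
  let ε' : D × ℕ ≃ₜ ℕ := ⟨ε, continuous_of_discreteTopology, continuous_of_discreteTopology⟩
  exact ⟨((Homeomorph.refl D).prodCongr A.symm).trans
    ((Homeomorph.prodAssoc _ _ _).symm.trans ((ε'.prodCongr (Homeomorph.refl _)).trans A))⟩

end BoxPower

/-! ### Open subgroups and functions vanishing on a compact set. -/

/-- A topological group is homeomorphic to the product of an open subgroup with the discrete space
of its cosets. -/
theorem AddSubgroup.nonempty_homeomorph_quotient_prod {G : Type*} [AddGroup G] [TopologicalSpace G]
    [IsTopologicalAddGroup G] (H : AddSubgroup G) (hH : IsOpen (H : Set G)) :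
    Nonempty (G ≃ₜ (G ⧸ H) × H) := by
  have := QuotientAddGroup.discreteTopology hH
  let σ : G ⧸ H → G := Quotient.out
  have hσ : ∀ q : G ⧸ H, (σ q : G ⧸ H) = q := QuotientAddGroup.out_eq'
  have hmem : ∀ x : G, -σ x + x ∈ H := fun x => QuotientAddGroup.eq.1 (hσ x)
  have hc : Continuous fun x : G => σ x :=
    (continuous_of_discreteTopology (f := σ)).comp QuotientAddGroup.continuous_mk
  have hmk : ∀ p : (G ⧸ H) × H, ((σ p.1 + p.2 : G) : G ⧸ H) = p.1 := fun p => by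
    rw [QuotientAddGroup.mk_add_of_mem _ p.2.2, hσ]
  refine ⟨⟨⟨fun x => (x, ⟨-σ x + x, hmem x⟩), fun p => σ p.1 + p.2, fun x => ?_, fun p => ?_⟩,
    ?_, ?_⟩⟩
  · simp
  · refine Prod.ext (hmk p) (Subtype.ext ?_)
    change -σ ((σ p.1 + p.2 : G) : G ⧸ H) + (σ p.1 + p.2) = p.2
    rw [hmk, neg_add_cancel_left]
  · exact QuotientAddGroup.continuous_mk.prodMk ((hc.neg.add continuous_id).subtype_mk _)
  · exact ((continuous_of_discreteTopology (f := σ)).comp continuous_fst).add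
      (continuous_subtype_val.comp continuous_snd)

/-- The subgroup of functions that vanish on a set. -/
def vanishingSubgroup {X : Type*} [TopologicalSpace X] (L : Set X) : AddSubgroup C(X, ZMod 2) :=
  (ContinuousMap.compAddMonoidHom' (γ := ZMod 2)
    (⟨((↑) : L → X), continuous_subtype_val⟩ : C(L, X))).ker

theorem mem_vanishingSubgroup {X : Type*} [TopologicalSpace X] {L : Set X} {f : C(X, ZMod 2)} :
    f ∈ vanishingSubgroup L ↔ ∀ x ∈ L, f x = 0 := by
  rw [vanishingSubgroup, AddMonoidHom.mem_ker, ContinuousMap.ext_iff]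
  exact Subtype.forall

theorem isOpen_vanishingSubgroup {X : Type*} [TopologicalSpace X] {L : Set X} (hL : IsCompact L) :
    IsOpen (vanishingSubgroup L : Set C(X, ZMod 2)) := by
  refine AddSubgroup.isOpen_of_mem_nhds (g := 0) _
    (mem_of_superset ((0 : C(X, ZMod 2)).hasBasis_nhds_eqOn.mem_of_mem hL) fun f hf => ?_)
  exact mem_vanishingSubgroup.2 hf

/-- The whole space is compact, so the function space is discrete; being separable, it is countable.
-/
theorem countable_continuousMap_of_compactSpace (X Y : Type*) [TopologicalSpace X] [CompactSpace X]
    [T2Space X] [SecondCountableTopology X] [TopologicalSpace Y] [DiscreteTopology Y]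
    [Countable Y] : Countable C(X, Y) := by
  have : DiscreteTopology C(X, Y) := by
    refine discreteTopology_iff_isOpen_singleton.2 fun f => isOpen_iff_mem_nhds.2 ?_
    rintro _ rfl
    refine mem_of_superset (ContinuousMap.hasBasis_nhds_eqOn _ |>.mem_of_mem isCompact_univ)
      fun g hg => ContinuousMap.ext fun x => hg (mem_univ x)
  have : SecondCountableTopology Y := inferInstance
  exact TopologicalSpace.separableSpace_iff_countable.1 inferInstance

theorem countable_quotient_vanishingSubgroup {X : Type*} [MetricSpace X] {L : Set X}
    (hL : IsCompact L) : Countable (C(X, ZMod 2) ⧸ vanishingSubgroup L) := by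
  have : CompactSpace L := isCompact_iff_compactSpace.1 hL
  have := countable_continuousMap_of_compactSpace L (ZMod 2)
  exact (QuotientAddGroup.kerLift_injective (ContinuousMap.compAddMonoidHom' (γ := ZMod 2)
    (⟨((↑) : L → X), continuous_subtype_val⟩ : C(L, X)))).countable

/-! ### Splitting the isolated points into pieces. -/

theorem IsCompact.of_forall_isOpen_finite_diff {X : Type*} [TopologicalSpace X] {L K : Set X}
    (hL : IsCompact L) (hLK : L ⊆ K) (h : ∀ O, IsOpen O → L ⊆ O → (K \ O).Finite) :
    IsCompact K := by
  refine isCompact_of_finite_subcover fun {ι} U hU hK => ?_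
  classical
  obtain ⟨t, ht⟩ := hL.elim_finite_subcover U hU (hLK.trans hK)
  have hfin := h _ (isOpen_biUnion fun i (_ : i ∈ t) => hU i) ht
  obtain ⟨t', ht'⟩ := hfin.isCompact.elim_finite_subcover U hU (sdiff_subset.trans hK)
  refine ⟨t ∪ t', fun x hx => ?_⟩
  by_cases hxt : x ∈ ⋃ i ∈ t, U i
  · exact biUnion_subset_biUnion_left (fun i hi => Finset.mem_union_left _ hi) hxt
  · exact biUnion_subset_biUnion_left (fun i hi => Finset.mem_union_right _ hi) (ht' ⟨hx, hxt⟩)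

/-- If the derived set is compact and the space is not locally compact, then every clopen
neighbourhood of the derived set contains a smaller one with infinite difference. -/
theorem exists_isClopen_infinite_diff {X : Type*} [MetricSpace X] (hX : IsZeroDimensional X)
    (hlc : ¬ LocallyCompactSpace X) (hL : IsCompact (derivedSet (univ : Set X))) {U O : Set X}
    (hU : IsClopen U) (hLU : derivedSet univ ⊆ U) (hO : IsOpen O) (hLO : derivedSet univ ⊆ O) :
    ∃ V, IsClopen V ∧ derivedSet univ ⊆ V ∧ V ⊆ U ∧ V ⊆ O ∧ (U \ V).Infinite := by
  have hUc : ¬ IsCompact U := by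
    intro hUc
    have : WeaklyLocallyCompactSpace X := ⟨fun x => by
      by_cases hx : x ∈ U
      · exact ⟨U, hUc, hU.isOpen.mem_nhds hx⟩
      · exact ⟨{x}, isCompact_singleton, (isOpen_singleton_of_notMem_derivedSet
          fun h => hx (hLU h)).mem_nhds rfl⟩⟩
    exact hlc inferInstance
  obtain ⟨W, hW, hLW, hinf⟩ : ∃ W, IsOpen W ∧ derivedSet univ ⊆ W ∧ (U \ W).Infinite := by
    by_contra! h
    exact hUc (hL.of_forall_isOpen_finite_diff hLU h)
  obtain ⟨V, hV, hLV, hVs⟩ := hX.exists_isClopen_between hL ((hU.isOpen.inter hW).inter hO)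
    (subset_inter (subset_inter hLU hLW) hLO)
  exact ⟨V, hV, hLV, fun x hx => (hVs hx).1.1, fun x hx => (hVs hx).2,
    hinf.mono fun x hx => ⟨hx.1, fun h => hx.2 (hVs h).1.2⟩⟩

theorem exists_equiv_compl_derivedSet {X : Type*} [MetricSpace X] [SecondCountableTopology X]
    (hX : IsZeroDimensional X) (hlc : ¬ LocallyCompactSpace X)
    (hL : IsCompact (derivedSet (univ : Set X))) :
    ∃ E : ℕ × ℕ ≃ ((derivedSet (univ : Set X))ᶜ : Set X),
      (∀ n, IsClosed (range fun m => (E (n, m) : X))) ∧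
      ∀ O : Set X, IsOpen O → derivedSet univ ⊆ O → ∃ N, ∀ n, N ≤ n → ∀ m, (E (n, m) : X) ∈ O := by
  set L := derivedSet (univ : Set X)
  let S := {U : Set X // IsClopen U ∧ L ⊆ U}
  have hstep : ∀ (n : ℕ) (U : S), ∃ V : S, V.1 ⊆ U.1 ∧
      V.1 ⊆ Metric.thickening (1 / ((n : ℝ) + 1)) L ∧ (U.1 \ V.1).Infinite := by
    intro n U
    obtain ⟨V, hV, hLV, hVU, hVt, hinf⟩ := exists_isClopen_infinite_diff hX hlc hL U.2.1 U.2.2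
      (Metric.isOpen_thickening (δ := 1 / ((n : ℝ) + 1)))
      (Metric.self_subset_thickening Nat.one_div_pos_of_nat _)
    exact ⟨⟨V, hV, hLV⟩, hVU, hVt, hinf⟩
  choose next hnext hthick hinf using hstep
  -- Starting from `univ` makes the differences `D n` exhaust the complement of `L`.
  let U : ℕ → S := fun n => Nat.rec ⟨univ, isClopen_univ, subset_univ _⟩ next n
  have hanti : Antitone fun n => (U n).1 := antitone_nat_of_succ_le fun n => hnext n (U n)
  let D : ℕ → Set X := fun n => (U n).1 \ (U (n + 1)).1
  have hDL : ∀ n, D n ⊆ Lᶜ := fun n x hx h => hx.2 ((U (n + 1)).2.2 h)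
  have hdisc : DiscreteTopology (Lᶜ : Set X) := discreteTopology_iff_isOpen_singleton.2 fun x => by
    have : ({x} : Set (Lᶜ : Set X)) = (↑) ⁻¹' {(x : X)} := by
      ext y; simp [Subtype.ext_iff]
    rw [this]
    exact (isOpen_singleton_of_notMem_derivedSet x.2).preimage continuous_subtype_val
  have hcount : Lᶜ.Countable :=
    TopologicalSpace.separableSpace_iff_countable.1 (inferInstance :
      TopologicalSpace.SeparableSpace (Lᶜ : Set X))
  have he : ∀ n, Nonempty (ℕ ≃ D n) := fun n => by
    have := (hcount.mono (hDL n)).to_subtype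
    have : Infinite (D n) := (hinf n (U n)).to_subtype
    exact nonempty_equiv_of_countable
  let e : ∀ n, ℕ ≃ D n := fun n => (he n).some
  let E₀ : ℕ × ℕ → (Lᶜ : Set X) := fun p => ⟨e p.1 p.2, hDL _ (e p.1 p.2).2⟩
  have hbij : Function.Bijective E₀ := by
    constructor
    · rintro ⟨n, m⟩ ⟨n', m'⟩ h
      have h : (e n m : X) = e n' m' := congrArg Subtype.val h
      have hle : ∀ {n n' m m'}, (e n m : X) = e n' m' → n ≤ n' := by
        intro n n' m m' h
        by_contra hlt
        have h1 := (e n m).2.1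
        rw [h] at h1
        exact (e n' m').2.2 (hanti (by omega : n' + 1 ≤ n) h1)
      obtain rfl : n = n' := le_antisymm (hle h) (hle h.symm)
      rw [(e n).injective (Subtype.ext h)]
    · rintro ⟨x, hx⟩
      have hex : ∃ n, x ∉ (U n).1 := by
        by_contra! h
        have hxL : x ∈ closure L := by
          refine Metric.mem_closure_iff.2 fun ε hε => ?_
          obtain ⟨n, hn⟩ := exists_nat_one_div_lt hε
          obtain ⟨y, hy, hxy⟩ := Metric.mem_thickening_iff.1 (hthick n (U n) (h (n + 1)))
          exact ⟨y, hy, hxy.trans hn⟩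
        exact hx (hL.isClosed.closure_eq ▸ hxL)
      classical
      obtain ⟨n, hn⟩ : ∃ n, Nat.find hex = n + 1 :=
        Nat.exists_eq_succ_of_ne_zero fun h => Nat.find_spec hex (h ▸ mem_univ x)
      have hxD : x ∈ D n := ⟨not_not.1 (Nat.find_min hex (by omega)), hn ▸ Nat.find_spec hex⟩
      refine ⟨(n, (e n).symm ⟨x, hxD⟩), Subtype.ext ?_⟩
      simp [E₀]
  refine ⟨Equiv.ofBijective E₀ hbij, fun n => ?_, fun O hO hLO => ?_⟩
  · have : (range fun m => (Equiv.ofBijective E₀ hbij (n, m) : X)) = D n := by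
      change (range fun m => (e n m : X)) = D n
      rw [range_comp' Subtype.val (e n), (e n).surjective.range_eq, image_univ, Subtype.range_coe]
    rw [this]
    exact (U n).2.1.isClosed.inter (U (n + 1)).2.1.compl.isClosed
  · obtain ⟨δ, hδ, hδO⟩ := hL.exists_thickening_subset_open hO hLO
    obtain ⟨N, hN⟩ := exists_nat_one_div_lt hδ
    -- The `N`-th thickening bounds the set chosen after `U N`, hence `N + 1`.
    refine ⟨N + 1, fun n hn m => hδO (Metric.thickening_mono hN.le L (hthick N (U N) ?_))⟩
    exact hanti hn (e n m).2.1

/-! ### The isomorphism with the box power and its consequence. -/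

/-- If the complement of a compact set `L` consists of isolated points and splits into a sequence
of countably infinite closed pieces that converges to `L`, then the functions that vanish on `L`
form a topological group isomorphic to `BoxPower CantorGroup`. -/
theorem nonempty_vanishingSubgroup_continuousAddEquiv {X : Type*} [TopologicalSpace X] [T2Space X]
    {L : Set X} (hL : IsCompact L) (hiso : ∀ x ∉ L, IsOpen {x}) (E : ℕ × ℕ ≃ (Lᶜ : Set X))
    (hcl : ∀ n, IsClosed (range fun m => (E (n, m) : X)))
    (hE : ∀ O : Set X, IsOpen O → L ⊆ O → ∃ N, ∀ n, N ≤ n → ∀ m, (E (n, m) : X) ∈ O) :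
    Nonempty (vanishingSubgroup L ≃ₜ+ BoxPower CantorGroup) := by
  classical
  have hex : ∀ g : BoxPower CantorGroup, ∃ f : vanishingSubgroup L,
      ∀ n m, f.1 (E (n, m)) = g.coord n m := by
    intro g
    let F : X → ZMod 2 := fun x =>
      if h : x ∈ L then 0 else g.coord (E.symm ⟨x, h⟩).1 (E.symm ⟨x, h⟩).2
    have hFL : ∀ x ∈ L, F x = 0 := fun x hx => dif_pos hx
    have hFE : ∀ n m, F (E (n, m)) = g.coord n m := fun n m => by
      have : F (E (n, m)) = _ := dif_neg (E (n, m)).2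
      simpa using this
    have hF : Continuous F := by
      refine continuous_iff_continuousAt.2 fun x => ?_
      by_cases hx : x ∈ L
      · obtain ⟨N, hN⟩ := g.exists_forall_coord_eq_zero
        -- Only the first `N` pieces carry nonzero values; they are closed and miss `L`.
        have hO : IsOpen (⋂ n ∈ Finset.range N, (range fun m => (E (n, m) : X))ᶜ) :=
          isOpen_biInter_finset fun n _ => (hcl n).isOpen_compl
        have hev : F =ᶠ[𝓝 x] fun _ => 0 := by
          filter_upwards [hO.mem_nhds (mem_iInter₂.2 fun n _ => by
            rintro ⟨m, rfl⟩
            exact (E (n, m)).2 hx)] with z hz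
          by_cases hzL : z ∈ L
          · exact hFL z hzL
          · obtain ⟨⟨n, m⟩, hnm⟩ := E.surjective ⟨z, hzL⟩
            have hnm : (E (n, m) : X) = z := congrArg Subtype.val hnm
            rw [← hnm, hFE]
            by_cases hn : N ≤ n
            · exact congrFun (hN n hn) m
            · exact absurd ⟨m, hnm⟩ (mem_iInter₂.1 hz n (Finset.mem_range.2 (not_le.1 hn)))
        exact continuousAt_const.congr hev.symm
      · rw [ContinuousAt, (isOpen_singleton_iff_nhds_eq_pure x).1 (hiso x hx)]
        exact tendsto_pure_nhds F x
    exact ⟨⟨⟨F, hF⟩, mem_vanishingSubgroup.2 hFL⟩, hFE⟩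
  choose Φ hΦ using hex
  have hext : ∀ f f' : vanishingSubgroup L, (∀ n m, f.1 (E (n, m)) = f'.1 (E (n, m))) → f = f' := by
    intro f f' h
    refine Subtype.ext (ContinuousMap.ext fun x => ?_)
    by_cases hx : x ∈ L
    · rw [mem_vanishingSubgroup.1 f.2 x hx, mem_vanishingSubgroup.1 f'.2 x hx]
    · obtain ⟨⟨n, m⟩, hnm⟩ := E.surjective ⟨x, hx⟩
      have hnm : (E (n, m) : X) = x := congrArg Subtype.val hnm
      rw [← hnm, h]
  have hbij : Function.Bijective Φ := by
    constructor
    · intro g g' h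
      refine BoxPower.coord_injective (funext fun n => funext fun m => ?_)
      rw [← hΦ, ← hΦ, h]
    · intro f
      -- The zero set of `f` is an open neighbourhood of `L`, so it contains almost all pieces.
      obtain ⟨N, hN⟩ := hE (f.1 ⁻¹' {0}) ((isOpen_discrete _).preimage f.1.continuous)
        fun x hx => mem_vanishingSubgroup.1 f.2 x hx
      obtain ⟨g, hg⟩ := BoxPower.exists_coord_eq (x := fun n m => f.1 (E (n, m))) (N := N)
        fun n hn => funext fun m => hN n hn m
      exact ⟨g, hext _ _ fun n m => by rw [hΦ, hg]⟩
  let A : BoxPower CantorGroup ≃+ vanishingSubgroup L :=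
    { Equiv.ofBijective Φ hbij with
      map_add' := fun g g' => hext _ _ fun n m => by
        change (Φ (g + g')).1 _ = (Φ g).1 _ + (Φ g').1 _
        rw [hΦ, hΦ, hΦ, BoxPower.coord_add]
        rfl }
  have hA : ∀ g n m, (A g).1 (E (n, m)) = g.coord n m := hΦ
  have hfin : ∀ K, IsCompact K → ∀ n, {m | (E (n, m) : X) ∈ K}.Finite := by
    intro K hK n
    have h1 : IsCompact (K ∩ range fun m => (E (n, m) : X)) := hK.inter_right (hcl n)
    have h2 : (K ∩ range fun m => (E (n, m) : X)).Finite := by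
      refine h1.finite ⟨discreteTopology_iff_isOpen_singleton.2 ?_⟩
      rintro ⟨x, hxK, m, rfl⟩
      refine ⟨_, hiso _ (E (n, m)).2, ?_⟩
      ext y
      simp [Subtype.ext_iff]
    refine (h2.preimage (f := fun m => (E (n, m) : X)) ?_).subset fun m hm => ⟨hm, m, rfl⟩
    intro m _ m' _ h
    exact (Prod.ext_iff.1 (E.injective (Subtype.ext h))).2
  have hnhds : ∀ f : vanishingSubgroup L, (𝓝 f).HasBasis (fun K : Set X => IsCompact K)
      fun K => {f' | EqOn f'.1 f.1 K} := fun f => by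
    rw [nhds_subtype]
    exact f.1.hasBasis_nhds_eqOn.comap _
  have hcont : Continuous A := by
    refine continuous_iff_continuousAt.2 fun g => ?_
    refine (g.hasBasis_nhds.tendsto_iff (hnhds _)).2 fun K hK =>
      ⟨fun n => (hfin K hK n).toFinset, trivial, fun g' hg' x hx => ?_⟩
    by_cases hxL : x ∈ L
    · rw [mem_vanishingSubgroup.1 (A g').2 x hxL, mem_vanishingSubgroup.1 (A g).2 x hxL]
    · obtain ⟨⟨n, m⟩, hnm⟩ := E.surjective ⟨x, hxL⟩
      have hnm : (E (n, m) : X) = x := congrArg Subtype.val hnm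
      subst hnm
      rw [hA, hA]
      exact hg' n m ((hfin K hK n).mem_toFinset.2 hx)
  have hcont' : Continuous A.symm := by
    refine continuous_iff_continuousAt.2 fun f => ?_
    refine ((hnhds f).tendsto_iff (A.symm f).hasBasis_nhds).2 fun F _ =>
      -- This set is compact: an open set containing `L` contains all pieces from some index on,
      -- leaving finitely many points.
      ⟨L ∪ ⋃ n, (fun m => (E (n, m) : X)) '' F n, ?_, fun f' hf' n m hm => ?_⟩
    · refine hL.of_forall_isOpen_finite_diff subset_union_left fun O hO hLO => ?_
      obtain ⟨N, hN⟩ := hE O hO hLO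
      refine ((finite_lt_nat N).biUnion fun n _ =>
        (F n).finite_toSet.image fun m => (E (n, m) : X)).subset ?_
      rintro x ⟨hx | hx, hxO⟩
      · exact absurd (hLO hx) hxO
      · obtain ⟨n, m, hm, rfl⟩ := mem_iUnion.1 hx
        exact mem_biUnion (not_le.1 fun h => hxO (hN n h m)) ⟨m, hm, rfl⟩
    · rw [← hA, ← hA, A.apply_symm_apply, A.apply_symm_apply]
      exact hf' (Or.inr (mem_iUnion.2 ⟨n, m, hm, rfl⟩))
  exact ⟨⟨A.symm, hcont', hcont⟩⟩

theorem nonempty_homeomorph_boxPower {X : Type*} [MetricSpace X] {L : Set X} (hL : IsCompact L)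
    (hH : Nonempty (vanishingSubgroup L ≃ₜ+ BoxPower CantorGroup)) :
    Nonempty (C(X, ZMod 2) ≃ₜ BoxPower CantorGroup) := by
  obtain ⟨A⟩ := hH
  obtain ⟨B⟩ := (vanishingSubgroup L).nonempty_homeomorph_quotient_prod
    (isOpen_vanishingSubgroup hL)
  have := QuotientAddGroup.discreteTopology (isOpen_vanishingSubgroup hL)
  have := countable_quotient_vanishingSubgroup hL
  obtain ⟨C⟩ := BoxPower.nonempty_homeomorph_prod (C(X, ZMod 2) ⧸ vanishingSubgroup L)
  exact ⟨B.trans (((Homeomorph.refl _).prodCongr A.toHomeomorph).trans C)⟩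

end

/- `C(X, ZMod 2)` carries the compact-open topology and pointwise addition; `ZMod 2` is discrete;
`derivedSet Set.univ` is the set of non-isolated points of `X`. -/
theorem theorem3p5 {X : Type*} [MetricSpace X] (hX : IsZeroDimensional X) :
    (SequentialSpace C(X, ZMod 2) ↔
      PolishSpace X ∧
        ((¬ LocallyCompactSpace X ∧ IsCompact (derivedSet (Set.univ : Set X))) ∨
          LocallyCompactSpace X)) ∧
    (PolishSpace X → ¬ LocallyCompactSpace X → IsCompact (derivedSet (Set.univ : Set X)) →
      (∃ H : AddSubgroup C(X, ZMod 2), IsOpen (H : Set C(X, ZMod 2)) ∧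
        Nonempty (H ≃ₜ+ BoxPower CantorGroup)) ∧
      Nonempty (C(X, ZMod 2) ≃ₜ BoxPower CantorGroup)) ∧
    (PolishSpace X → LocallyCompactSpace X → PolishSpace C(X, ZMod 2)) := by
  have hmain : PolishSpace X → ¬ LocallyCompactSpace X →
      IsCompact (derivedSet (Set.univ : Set X)) →
      (∃ H : AddSubgroup C(X, ZMod 2), IsOpen (H : Set C(X, ZMod 2)) ∧
        Nonempty (H ≃ₜ+ BoxPower CantorGroup)) ∧
      Nonempty (C(X, ZMod 2) ≃ₜ BoxPower CantorGroup) := by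
    intro _ hlc hL
    obtain ⟨E, hcl, hE⟩ := exists_equiv_compl_derivedSet hX hlc hL
    have hiso := nonempty_vanishingSubgroup_continuousAddEquiv hL
      (fun x hx => isOpen_singleton_of_notMem_derivedSet hx) E hcl hE
    exact ⟨⟨_, isOpen_vanishingSubgroup hL, hiso⟩, nonempty_homeomorph_boxPower hL hiso⟩
  have hpolish : PolishSpace X → LocallyCompactSpace X → PolishSpace C(X, ZMod 2) :=
    fun _ _ => polishSpace_continuousMap_of_locallyCompactSpace
  refine ⟨⟨fun hseq => ?_, ?_⟩, hmain, hpolish⟩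
  · have := secondCountableTopology_of_sequentialSpace hX hseq
    rcases locallyCompactSpace_or_isCompact_derivedSet hX hseq with h | h
    · exact ⟨polishSpace_of_locallyCompactSpace, Or.inr h⟩
    · refine ⟨polishSpace_of_isCompact_derivedSet h, ?_⟩
      by_cases hlc : LocallyCompactSpace X
      exacts [Or.inr hlc, Or.inl ⟨hlc, h⟩]
  · rintro ⟨hP, ⟨hlc, hL⟩ | hlc⟩
    · obtain ⟨A⟩ := (hmain hP hlc hL).2
      exact A.symm.isQuotientMap.sequentialSpace
    · have := hpolish hP hlc
      infer_instance
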